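/- For integers $m\ge 0$ and $r\ge 0$ let $\mathrm{RM}(m,r)$ be the binary Reed--Muller code of blocklength $N=2^m$: the set of evaluation vectors $(f(\mathbf z):\mathbf z\in\mathbb F_2^m)$ of polynomials $f\in\mathbb F_2[x_1,\dots,x_m]$ of degree at most $r$. Words $\mathbf Y=(Y_{\mathbf x})$ are indexed by the points $\mathbf x$ of $\mathbb F_2^m$ or, more generally, of a finite vector space $V$ over $\mathbb F_2$ (such as a quotient of $\mathbb F_2^m$). The recursive projection-aggregation (RPA) decoder with one-dimensional subspaces and at most $M\ge 1$ iterations is defined as follows. In order $1$ it is a maximum likelihood decoder: it outputs a word at minimum Hamming distance from $\mathbf Y$ in the first-order Reed--Muller code (the affine functions $V\to\mathbb F_2$), with ties broken by an arbitrary fixed rule. In order $r\ge 2$ an iteration acts on $\mathbf Y$ thus: for every one-dimensional subspace $\mathbb B$ of $V$ the projection $\mathbf Y_{/\mathbb B}$, whose coordinate at a coset $T\in V/\mathbb B$ is $\bigoplus_{\mathbf x\in T}Y_{\mathbf x}$, is decoded to $\widehat{\mathbf Y}_{/\mathbb B}$ by the RPA decoder of order $r-1$ on $V/\mathbb B$;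 then $Y_{\mathbf x}$ is flipped, simultaneously for all $\mathbf x$ such that $Y_{/\mathbb B}(\mathbf x+\mathbb B)\ne \widehat Y_{/\mathbb B}(\mathbf x+\mathbb B)$ for more than half of the subspaces $\mathbb B$. The iteration is repeated until $\mathbf Y$ does not change, but at most $M$ times (with the same $M$ in all recursive calls), and the final $\mathbf Y$ is returned. Let $P_{\mathrm{err}}(\mathrm{RM}(m,r))=\Pr[\widehat{\mathbf C}\ne\mathbf C]$, where $\mathbf C$ is uniformly distributed on $\mathrm{RM}(m,r)$ and $\widehat{\mathbf C}$ is the output of the RPA decoder of order $r$ for the received word $\mathbf C\oplus\boldsymbol\nu$; here $\boldsymbol\nu$ is independent of $\mathbf C$ and has i.i.d. $\mathrm{Bernoulli}(p)$ coordinates (transmission over $\mathrm{BSC}(p)$). Let $p\in(0,\tfrac12)$ and $c(p)=\frac{\log 2}{\log(1/(1-2p))}$, and fix a constant $0<\bar c<c(p)$. Let $(r_m)$ be any sequence of orders such that $1\le r_m\le\log_2(\bar c\,m)$ for all sufficiently large $m$, and let $M_m\ge1$ be any iteration limits. Then $$\lim_{m\to\infty}P_{\mathrm{err}}(\mathrm{RM}(m,r_m))=0,$$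 where for each $m$ the decoder is run with at most $M_m$ iterations. -/

import Mathlib

open Filter Topology

namespace RPA

/-- The evaluation points `{0,1}^m`, as a vector space over the field with two elements. -/
abbrev Cube (m : ℕ) : Type := Fin m → ZMod 2

/-- The Reed-Muller code `RM(m,r)`: the evaluation vectors on `{0,1}^m` of the polynomials of degree
at most `r` in `m` variables over the field with two elements. -/
def reedMuller (m r : ℕ) : Set (Cube m → ZMod 2) :=
  {c | ∃ f : MvPolynomial (Fin m) (ZMod 2), f.totalDegree ≤ r ∧
    ∀ z : Cube m, c z = MvPolynomial.eval z f}

/-! The projections of a word are indexed by the cosets of a subspace, so the decoder is defined on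
words indexed by an arbitrary finite vector space `V` over `ZMod 2`; the quotient spaces `V ⧸ B` are
then used as they are, with no choice of an ordering of the cosets. -/

/-- The first-order Reed-Muller code on the points of `V`: evaluation vectors of the polynomial
functions of degree at most one, that is, of the affine functions. -/
def firstOrderCode (V : Type) [AddCommGroup V] [Module (ZMod 2) V] : Set (V → ZMod 2) :=
  {f | ∃ (l : V →ₗ[ZMod 2] ZMod 2) (a : ZMod 2), ∀ x, f x = l x + a}

/-- On `{0,1}^m` the first-order code is `RM(m,1)`. -/
theorem firstOrderCode_cube (m : ℕ) : firstOrderCode (Cube m) = reedMuller m 1 := by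
  ext c
  constructor
  · rintro ⟨l, a, h⟩
    refine ⟨(∑ i, MvPolynomial.C (l (Pi.single i 1)) * MvPolynomial.X i) + MvPolynomial.C a,
      ?_, ?_⟩
    · refine (MvPolynomial.totalDegree_add _ _).trans (max_le ?_ (by simp))
      refine MvPolynomial.totalDegree_finsetSum_le fun i _ => ?_
      refine (MvPolynomial.totalDegree_mul _ _).trans ?_
      simp
    · intro z
      rw [h z]
      simp only [map_add, map_sum, map_mul, MvPolynomial.eval_C, MvPolynomial.eval_X]
      congr 1
      rw [LinearMap.pi_apply_eq_sum_univ l z]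
      refine Finset.sum_congr rfl fun i _ => ?_
      rw [smul_eq_mul, mul_comm]
      congr 2
      ext j
      simp [Pi.single_apply, eq_comm]
  · rintro ⟨f, hf, h⟩
    have key : ∀ s ∈ f.support, ∃ (l : Cube m →ₗ[ZMod 2] ZMod 2) (a : ZMod 2),
        ∀ x, MvPolynomial.eval x (MvPolynomial.monomial s (f.coeff s)) = l x + a := by
      intro s hs
      have hd : s.degree ≤ 1 := by
        have := (MvPolynomial.le_totalDegree hs).trans hf
        exact this
      rcases Nat.le_one_iff_eq_zero_or_eq_one.mp hd with h0 | h1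
      · rw [Finsupp.degree_eq_zero_iff] at h0
        subst h0
        exact ⟨0, f.coeff 0, fun x => by simp⟩
      · obtain ⟨i, rfl⟩ : ∃ i, s = Finsupp.single i 1 := by
          have hs0 : s ≠ 0 := fun h0 => by simp [h0] at h1
          obtain ⟨i, hi⟩ := Finsupp.ne_iff.mp hs0
          have hle : Finsupp.single i 1 ≤ s :=
            Finsupp.single_le_iff.mpr (Nat.one_le_iff_ne_zero.mpr hi)
          obtain ⟨t, rfl⟩ := exists_add_of_le hle
          have ht : t = 0 := by
            rw [map_add, Finsupp.degree_single] at h1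
            exact (Finsupp.degree_eq_zero_iff t).mp (by omega)
          exact ⟨i, by rw [ht, add_zero]⟩
        exact ⟨f.coeff (Finsupp.single i 1) • LinearMap.proj i, 0, fun x => by
          simp [MvPolynomial.eval_monomial]⟩
    choose! l a hla using key
    refine ⟨∑ s ∈ f.support, l s, ∑ s ∈ f.support, a s, fun x => ?_⟩
    rw [h x, LinearMap.sum_apply, ← Finset.sum_add_distrib]
    conv_lhs => rw [f.as_sum, map_sum]
    exact Finset.sum_congr rfl fun s hs => hla s hs x

/-- Hamming distance of two words. -/
noncomputable def hamming {V : Type} (u v : V → ZMod 2) : ℕ := {x | u x ≠ v x}.ncard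

/-- A maximum likelihood decoder for first-order Reed-Muller codes over the binary symmetric channel
(with crossover probability below one half): it returns a codeword at minimum Hamming distance from
the received word. How ties are broken is left free. -/
structure FirstOrderMLDecoder where
  decode : ∀ (V : Type) [AddCommGroup V] [Module (ZMod 2) V] [Finite V],
    (V → ZMod 2) → (V → ZMod 2)
  decode_mem : ∀ (V : Type) [AddCommGroup V] [Module (ZMod 2) V] [Finite V] (Y : V → ZMod 2),
    decode V Y ∈ firstOrderCode V
  hamming_decode_le : ∀ (V : Type) [AddCommGroup V] [Module (ZMod 2) V] [Finite V] (Y : V → ZMod 2),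
    ∀ f ∈ firstOrderCode V, hamming Y (decode V Y) ≤ hamming Y f

theorem exists_nearest (V : Type) [AddCommGroup V] [Module (ZMod 2) V] (Y : V → ZMod 2) :
    ∃ g ∈ firstOrderCode V, ∀ f ∈ firstOrderCode V, hamming Y g ≤ hamming Y f := by
  have hne : (firstOrderCode V).Nonempty := ⟨fun _ => 0, 0, 0, fun x => by simp⟩
  obtain ⟨g, hg, hmin⟩ := WellFounded.has_min
    (InvImage.wf (fun f : V → ZMod 2 => hamming Y f) Nat.lt_wfRel.wf) _ hne
  exact ⟨g, hg, fun f hf => not_lt.mp (hmin f hf)⟩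

instance : Nonempty FirstOrderMLDecoder :=
  ⟨{ decode := fun V _ _ _ Y => (exists_nearest V Y).choose
     decode_mem := fun V _ _ _ Y => (exists_nearest V Y).choose_spec.1
     hamming_decode_le := fun V _ _ _ Y => (exists_nearest V Y).choose_spec.2 }⟩

section Decoder

variable {V : Type} [AddCommGroup V] [Module (ZMod 2) V]

/-- The one-dimensional subspaces of `V`. -/
abbrev Line (V : Type) [AddCommGroup V] [Module (ZMod 2) V] : Type :=
  {B : Submodule (ZMod 2) V // Module.finrank (ZMod 2) B = 1}

/-- The projection of the word `Y` onto the cosets of `B`: its value at a coset is the sum modulo 2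
of the coordinates of `Y` with index in that coset. -/
noncomputable def project (Y : V → ZMod 2) (B : Submodule (ZMod 2) V) : (V ⧸ B) → ZMod 2 :=
  fun T => ∑ᶠ (x : V) (_ : B.mkQ x = T), Y x

/-- The number of subspaces `B` for which the projection of `Y` and the decoded estimate `Yhat B` of
it disagree at the coset of `x`. -/
noncomputable def disagreements (Y : V → ZMod 2) (Yhat : ∀ B : Line V, (V ⧸ B.1) → ZMod 2)
    (x : V) : ℕ :=
  {B : Line V | project Y B.1 (B.1.mkQ x) ≠ Yhat B (B.1.mkQ x)}.ncard

open scoped Classical in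
/-- The aggregation step: the coordinate of `Y` at `x` is flipped if more than half of all the
one-dimensional subspaces disagree at `x`. -/
noncomputable def aggregate (Y : V → ZMod 2) (Yhat : ∀ B : Line V, (V ⧸ B.1) → ZMod 2) :
    V → ZMod 2 :=
  fun x => Y x + if (Nat.card (Line V) : ℝ) / 2 < (disagreements Y Yhat x : ℝ) then 1 else 0

open scoped Classical in
/-- At most `M` rounds of `Y ← step Y`, stopped as soon as a round does not change `Y`. -/
noncomputable def iterate (step : (V → ZMod 2) → (V → ZMod 2)) : ℕ → (V → ZMod 2) → (V → ZMod 2)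
  | 0, Y => Y
  | M + 1, Y => if Y = step Y then Y else iterate step M (step Y)

end Decoder

instance finite_quotient (V : Type) [AddCommGroup V] [Module (ZMod 2) V] [Finite V]
    (B : Submodule (ZMod 2) V) : Finite (V ⧸ B) :=
  Finite.of_surjective _ B.mkQ_surjective

/-- The recursive projection-aggregation decoder of order `r` with one-dimensional subspaces and at
most `M` iterations in each recursive call. In order 1 it is the maximum likelihood decoder; in order
`r ≥ 2` each iteration projects onto the cosets of all one-dimensional subspaces, decodes the
projections in order `r - 1`, and aggregates. (The value in order 0 is a placeholder.) -/
noncomputable def rpa (D : FirstOrderMLDecoder) (M : ℕ) :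
    ℕ → ∀ (V : Type) [AddCommGroup V] [Module (ZMod 2) V] [Finite V],
      (V → ZMod 2) → (V → ZMod 2)
  | 0, _, _, _, _ => fun Y => Y
  | 1, V, _, _, _ => fun Y => D.decode V Y
  | r + 2, V, _, _, _ => fun Y =>
      iterate (fun Z => aggregate Z (fun B => rpa D M (r + 1) (V ⧸ B.1) (project Z B.1))) M Y

/-- The probability of the noise word `ν` on BSC(p): the coordinates are i.i.d. Bernoulli(p). -/
noncomputable def noiseProb (p : ℝ) {m : ℕ} (ν : Cube m → ZMod 2) : ℝ :=
  ∏ z, if ν z = 1 then p else 1 - p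

open scoped Classical in
/-- The probability over the noise of BSC(p) that the transmitted word `c` is not recovered by the
decoder of order `r`. -/
noncomputable def wordErrorProb (D : FirstOrderMLDecoder) (M : ℕ) (p : ℝ) (m r : ℕ)
    (c : Cube m → ZMod 2) : ℝ :=
  ∑ ν : Cube m → ZMod 2, if rpa D M r (Cube m) (c + ν) ≠ c then noiseProb p ν else 0

open scoped Classical in
/-- The error probability of `RM(m,r)` over BSC(p) under RPA decoding, for a codeword that is chosen
uniformly at random and independently of the noise. -/
noncomputable def errorProb (D : FirstOrderMLDecoder) (M : ℕ) (p : ℝ) (m r : ℕ) : ℝ :=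
  (∑ c : reedMuller m r, wordErrorProb D M p m r c) / Fintype.card (reedMuller m r)

end RPA

/-!
Only the first iteration of the decoder matters. Write the received word as `c + ν` with `c` a
codeword. If every projection of `c + ν` onto a line is decoded to the projection of `c`, then the
line in direction `b` disagrees at `x` exactly when `ν (x + b) ≠ ν x`. Hence if fewer than half of the
coordinates of `ν` are one, the majority vote flips precisely the coordinates in error, and one
iteration returns `c`. The same reasoning with `ν = 0` shows that codewords are fixed, so later
iterations do no harm. By recursion, the decoder succeeds whenever `ν` and all its iterated
projections have weight below one half, and the projections at the last level do not mislead the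
maximum likelihood decoder (`RPA.Correctable`, `RPA.rpa_eq_of_correctable`). That projections of
codewords are codewords of the order below is seen by describing Reed-Muller codes through vanishing
iterated derivatives, since projecting onto a line is taking a derivative (`RPA.DegreeLT`).

The noise is a word of independent bits of bias `θ = 1 - 2 * p`. A projection adds the bits in pairs,
so its bits are again independent, with bias `θ ^ 2` (`RPA.noiseMass_project`). A Chernoff bound shows
that at least half of `n` bits of bias `θ` are one with probability at most `(1 - θ ^ 2 / 2) ^ n`
(`RPA.noiseMass_majority_le`). The union bound over the recursion gives, for order `r` and blocklength
`2 ^ m`, the failure probability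
`2 ^ ((m + 1) * r) * (1 - θ ^ 2 ^ r / 2) ^ 2 ^ (m - r)` (`RPA.noiseMass_not_correctable_le`).

If `2 ^ r ≤ cbar * m`, then `θ ^ 2 ^ r * 2 ^ (m - r) ≥ (2 * θ ^ cbar) ^ m / (cbar * m)`. The condition
on `cbar` says that `2 * θ ^ cbar > 1`, so this grows exponentially and beats the number of events,
which is only `exp (O (m ^ 2))`.
-/

namespace RPA

/-! ### Lines and projections -/

theorem eq_zero_or_eq_one : ∀ a : ZMod 2, a = 0 ∨ a = 1 := by decide

section Lines

variable {V : Type} [AddCommGroup V] [Module (ZMod 2) V]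

/-- Over the field with two elements a line consists of zero and one nonzero vector. -/
theorem Line.exists_direction (B : Line V) :
    ∃ b : V, b ≠ 0 ∧ ∀ y : V, y ∈ B.1 ↔ y = 0 ∨ y = b := by
  obtain ⟨⟨b, hbB⟩, hb0, hb⟩ := finrank_eq_one_iff'.mp B.2
  refine ⟨b, fun h => hb0 (Subtype.ext h), fun y => ⟨fun hy => ?_, ?_⟩⟩
  · obtain ⟨a, ha⟩ := hb ⟨y, hy⟩
    have ha' : a • b = y := congrArg Subtype.val ha
    rcases eq_zero_or_eq_one a with rfl | rfl
    · left; simpa using ha'.symm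
    · right; simpa using ha'.symm
  · rintro (rfl | rfl)
    · exact B.1.zero_mem
    · exact hbB

/-- The line through the origin in the direction of a nonzero vector. -/
def lineThrough (b : V) (hb : b ≠ 0) : Line V :=
  ⟨Submodule.span (ZMod 2) {b}, finrank_span_singleton hb⟩

theorem mem_lineThrough (b : V) (hb : b ≠ 0) (y : V) :
    y ∈ (lineThrough b hb).1 ↔ y = 0 ∨ y = b := by
  refine Submodule.mem_span_singleton.trans ⟨?_, ?_⟩
  · rintro ⟨a, rfl⟩
    rcases eq_zero_or_eq_one a with rfl | rfl <;> simp
  · rintro (rfl | rfl)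
    · exact ⟨0, by simp⟩
    · exact ⟨1, by simp⟩

theorem lineThrough_injective {b b' : V} {hb : b ≠ 0} {hb' : b' ≠ 0}
    (h : lineThrough b hb = lineThrough b' hb') : b = b' := by
  have h1 : b ∈ (lineThrough b' hb').1 := h ▸ (mem_lineThrough b hb b).mpr (Or.inr rfl)
  exact ((mem_lineThrough b' hb' b).mp h1).resolve_left hb

theorem lineThrough_surjective (B : Line V) : ∃ b, ∃ hb : b ≠ 0, lineThrough b hb = B := by
  obtain ⟨b, hb, h⟩ := B.exists_direction
  refine ⟨b, hb, Subtype.ext (Submodule.ext fun y => ?_)⟩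
  rw [mem_lineThrough, h]

theorem mkQ_eq_iff {B : Line V} {b : V} (hB : ∀ y : V, y ∈ B.1 ↔ y = 0 ∨ y = b) (x y : V) :
    B.1.mkQ y = B.1.mkQ x ↔ y = x ∨ y = x + b := by
  rw [Submodule.mkQ_apply, Submodule.mkQ_apply, Submodule.Quotient.eq, hB, sub_eq_zero,
    sub_eq_iff_eq_add, add_comm b x]

/-- The value of a projection onto a line at the coset `{x, x + b}`. -/
theorem project_mkQ {B : Line V} {b : V} (hb : b ≠ 0)
    (hB : ∀ y : V, y ∈ B.1 ↔ y = 0 ∨ y = b) (Y : V → ZMod 2) (x : V) :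
    project Y B.1 (B.1.mkQ x) = Y x + Y (x + b) := by
  have hne : x ≠ x + b := by simpa using hb
  rw [← finsum_mem_pair hne]
  refine finsum_congr fun y => ?_
  rw [mkQ_eq_iff hB, Set.mem_insert_iff, Set.mem_singleton_iff]

theorem project_add (B : Line V) (Y Z : V → ZMod 2) :
    project (Y + Z) B.1 = project Y B.1 + project Z B.1 := by
  obtain ⟨b, hb, hB⟩ := B.exists_direction
  funext T
  obtain ⟨x, rfl⟩ := B.1.mkQ_surjective T
  simp only [Pi.add_apply, project_mkQ hb hB]
  ring

theorem project_zero (B : Line V) : project (0 : V → ZMod 2) B.1 = 0 := by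
  funext T
  simp [project]

theorem card_line_add_one [Finite V] : Nat.card (Line V) + 1 = Nat.card V := by
  have h : ({0}ᶜ : Set V).ncard = (Set.univ : Set (Line V)).ncard :=
    Set.ncard_congr (fun b hb => lineThrough b hb) (fun _ _ => Set.mem_univ _)
      (fun _ _ _ _ h => lineThrough_injective h)
      (fun B _ => by
        obtain ⟨b, hb, h⟩ := lineThrough_surjective B
        exact ⟨b, hb, h⟩)
  rw [Set.ncard_univ] at h
  rw [← h, ← Set.ncard_add_ncard_compl ({0} : Set V), Set.ncard_singleton, add_comm]

theorem finrank_quotient_line [Finite V] (B : Line V) :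
    Module.finrank (ZMod 2) (V ⧸ B.1) = Module.finrank (ZMod 2) V - 1 := by
  have : Module.Finite (ZMod 2) V := Module.Finite.of_finite
  rw [Submodule.finrank_quotient, B.2]

theorem natCard_eq_two_pow (V : Type) [AddCommGroup V] [Module (ZMod 2) V] [Finite V] :
    Nat.card V = 2 ^ Module.finrank (ZMod 2) V := by
  have : Module.Finite (ZMod 2) V := Module.Finite.of_finite
  rw [Module.natCard_eq_pow_finrank (K := ZMod 2), Nat.card_zmod]

end Lines

/-! ### Reed-Muller codewords through iterated derivatives -/

/-- `DegreeLT n V` is the set of the functions on `V` all of whose `n`-fold directional derivatives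
`x ↦ f x + f (x + b)` vanish, which are the polynomial functions of degree less than `n`. No
coordinates of `V` are involved, so the notion passes to quotients. -/
def DegreeLT : ℕ → ∀ (V : Type) [AddCommGroup V], Set (V → ZMod 2)
  | 0, _, _ => {0}
  | n + 1, V, _ => {f | ∀ b : V, (fun x => f x + f (x + b)) ∈ DegreeLT n V}

section DegreeLT

variable {V W : Type} [AddCommGroup V] [AddCommGroup W]

theorem zero_mem_degreeLT (n : ℕ) : (0 : V → ZMod 2) ∈ DegreeLT n V := by
  induction n with
  | zero => rfl
  | succ n ih => exact fun b => by simpa using! ih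

theorem add_mem_degreeLT {n : ℕ} {f g : V → ZMod 2} (hf : f ∈ DegreeLT n V)
    (hg : g ∈ DegreeLT n V) : f + g ∈ DegreeLT n V := by
  induction n generalizing f g with
  | zero =>
    obtain rfl : f = 0 := hf
    obtain rfl : g = 0 := hg
    exact add_zero 0
  | succ n ih =>
    intro b
    have h := ih (hf b) (hg b)
    convert h using 1
    funext x
    simp only [Pi.add_apply]
    ring

theorem degreeLT_succ {n : ℕ} {f : V → ZMod 2} (hf : f ∈ DegreeLT n V) :
    f ∈ DegreeLT (n + 1) V := by
  induction n generalizing f with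
  | zero =>
    obtain rfl : f = 0 := hf
    exact zero_mem_degreeLT 1
  | succ n ih => exact fun b => ih (hf b)

theorem degreeLT_mono {n k : ℕ} (h : n ≤ k) : DegreeLT n V ⊆ DegreeLT k V := by
  induction h with
  | refl => exact subset_rfl
  | step _ ih => exact fun f hf => degreeLT_succ (ih hf)

theorem translate_mem_degreeLT {n : ℕ} {f : V → ZMod 2} (hf : f ∈ DegreeLT n V) (a : V) :
    (fun x => f (x + a)) ∈ DegreeLT n V := by
  induction n generalizing f with
  | zero =>
    obtain rfl : f = 0 := hf
    rfl
  | succ n ih =>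
    intro b
    convert ih (hf b) using 1
    funext x
    rw [add_right_comm]

theorem const_mul_mem_degreeLT {n : ℕ} {f : V → ZMod 2} (hf : f ∈ DegreeLT n V) (a : ZMod 2) :
    (fun x => a * f x) ∈ DegreeLT n V := by
  rcases eq_zero_or_eq_one a with rfl | rfl
  · simpa using! zero_mem_degreeLT (V := V) n
  · simpa using hf

/-- Multiplication by an additive function raises the degree by at most one. -/
theorem additive_mul_mem_degreeLT {n : ℕ} (l : V →+ ZMod 2) {f : V → ZMod 2}
    (hf : f ∈ DegreeLT n V) : (fun x => l x * f x) ∈ DegreeLT (n + 1) V := by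
  induction n generalizing f with
  | zero =>
    obtain rfl : f = 0 := hf
    simpa using! zero_mem_degreeLT (V := V) 1
  | succ n ih =>
    intro b
    convert add_mem_degreeLT (ih (hf b))
      (const_mul_mem_degreeLT (translate_mem_degreeLT hf b) (l b)) using 1
    funext x
    simp only [Pi.add_apply, map_add]
    ring

theorem const_mem_degreeLT (a : ZMod 2) : (fun _ => a) ∈ DegreeLT 1 V := fun _ =>
  funext fun _ => CharTwo.add_self_eq_zero a

theorem comp_mem_degreeLT {n : ℕ} (π : V →+ W) (hπ : Function.Surjective π) {g : W → ZMod 2}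
    (h : (fun x => g (π x)) ∈ DegreeLT n V) : g ∈ DegreeLT n W := by
  induction n generalizing g with
  | zero =>
    funext w
    obtain ⟨x, rfl⟩ := hπ w
    exact congrFun h x
  | succ n ih =>
    intro b
    obtain ⟨a, rfl⟩ := hπ b
    refine ih ?_
    simpa using h a

/-- Projecting onto a line takes a directional derivative, and so lowers the degree. -/
theorem project_mem_degreeLT [Module (ZMod 2) V] {n : ℕ} {c : V → ZMod 2}
    (hc : c ∈ DegreeLT (n + 1) V) (B : Line V) : project c B.1 ∈ DegreeLT n (V ⧸ B.1) := by
  obtain ⟨b, hb, hB⟩ := B.exists_direction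
  refine comp_mem_degreeLT B.1.mkQ.toAddMonoidHom B.1.mkQ_surjective ?_
  convert hc b using 1
  funext x
  exact project_mkQ hb hB c x

theorem degreeLT_two_subset [Module (ZMod 2) V] : DegreeLT 2 V ⊆ firstOrderCode V := by
  intro c hc
  have h : ∀ a b x, c x + c (x + a) + (c (x + b) + c (x + b + a)) = 0 := fun a b x =>
    congrFun (hc a b) x
  refine ⟨AddMonoidHom.toZModLinearMap 2 (AddMonoidHom.mk' (fun x => c x + c 0) fun x y => ?_),
    c 0, fun x => ?_⟩
  · have h1 := h y x 0
    simp only [zero_add] at h1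
    generalize c (x + y) = p at *
    generalize c x = q at *
    generalize c y = r at *
    generalize c 0 = s at *
    revert p q r s
    decide
  · change c x = c x + c 0 + c 0
    rw [add_assoc, CharTwo.add_self_eq_zero, add_zero]

end DegreeLT

theorem reedMuller_subset_degreeLT (m r : ℕ) : reedMuller m r ⊆ DegreeLT (r + 1) (Cube m) := by
  have mono : ∀ s : Multiset (Fin m),
      (fun z : Cube m => (s.map z).prod) ∈ DegreeLT (s.card + 1) (Cube m) := by
    intro s
    induction s using Multiset.induction with
    | empty => simpa using const_mem_degreeLT (V := Cube m) 1
    | cons i s ih =>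
      simpa using additive_mul_mem_degreeLT (Pi.evalAddMonoidHom (fun _ => ZMod 2) i) ih
  rintro c ⟨f, hf, hc⟩
  have key : ∀ t : Finset (Fin m →₀ ℕ), t ⊆ f.support →
      (fun z : Cube m => ∑ s ∈ t, MvPolynomial.eval z (MvPolynomial.monomial s (f.coeff s)))
        ∈ DegreeLT (r + 1) (Cube m) := by
    intro t
    induction t using Finset.induction_on with
    | empty => intro _; simpa using! zero_mem_degreeLT (V := Cube m) (r + 1)
    | insert s t hs ih =>
      intro ht
      have hsf := ht (Finset.mem_insert_self s t)
      have hcard : (Finsupp.toMultiset s).card ≤ r := by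
        rw [MvPolynomial.totalDegree_eq] at hf
        exact (Finset.le_sup (f := fun s => (Finsupp.toMultiset s).card) hsf).trans hf
      have h1 := const_mul_mem_degreeLT
        (degreeLT_mono (Nat.succ_le_succ hcard) (mono (Finsupp.toMultiset s))) (f.coeff s)
      convert add_mem_degreeLT h1 (ih fun u hu => ht (Finset.mem_insert_of_mem hu)) using 1
      funext z
      rw [Finset.sum_insert hs, MvPolynomial.eval_monomial]
      simp only [Pi.add_apply]
      congr 2
      rw [Finsupp.toMultiset_map, Finsupp.prod_toMultiset, Finsupp.prod_mapDomain_index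
        (fun _ => pow_zero _) (fun _ _ _ => pow_add _ _ _)]
  convert key f.support subset_rfl using 1
  funext z
  rw [hc z]
  conv_lhs => rw [f.as_sum, map_sum]

/-! ### Noise patterns that the decoder corrects -/

/-- A sufficient condition on the noise `ν` for the decoder of order `k + 1` to recover every
codeword. In order one, `ν` hits less than half of the support of every nonzero affine function. In
higher orders, `ν` has weight less than half of the length and its projections onto all lines satisfy
the condition of the order below. -/
def Correctable : ℕ → ∀ (V : Type) [AddCommGroup V] [Module (ZMod 2) V], (V → ZMod 2) → Prop
  | 0, V, _, _ => fun ν => ∀ f ∈ firstOrderCode V, f ≠ 0 →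
      2 * {x | f x = 1 ∧ ν x = 1}.ncard < {x | f x = 1}.ncard
  | k + 1, V, _, _ => fun ν => 2 * {x | ν x = 1}.ncard < Nat.card V ∧
      ∀ B : Line V, Correctable k (V ⧸ B.1) (project ν B.1)

section Correctable

variable {V : Type} [AddCommGroup V] [Module (ZMod 2) V] [Finite V]

theorem eq_one_of_ne_zero {a : ZMod 2} (h : a ≠ 0) : a = 1 := by
  revert a; decide

theorem correctable_zero (k : ℕ) : ∀ (V : Type) [AddCommGroup V] [Module (ZMod 2) V] [Finite V],
    Correctable k V 0 := by
  induction k with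
  | zero =>
    intro V _ _ _ f _ hf
    obtain ⟨x, hx⟩ := Function.ne_iff.mp hf
    have : 0 < {x | f x = 1}.ncard :=
      (Set.ncard_pos (Set.toFinite _)).mpr ⟨x, eq_one_of_ne_zero hx⟩
    simpa using this
  | succ k ih =>
    intro V _ _ _
    refine ⟨by simp, fun B => ?_⟩
    rw [project_zero]
    exact ih _

theorem add_mem_firstOrderCode {V : Type} [AddCommGroup V] [Module (ZMod 2) V]
    {f g : V → ZMod 2} (hf : f ∈ firstOrderCode V)
    (hg : g ∈ firstOrderCode V) : f + g ∈ firstOrderCode V := by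
  obtain ⟨l, a, h⟩ := hf
  obtain ⟨l', a', h'⟩ := hg
  refine ⟨l + l', a + a', fun x => ?_⟩
  rw [Pi.add_apply, h, h', LinearMap.add_apply]
  ring

theorem decode_eq_of_correctable (D : FirstOrderMLDecoder) {c ν : V → ZMod 2}
    (hc : c ∈ firstOrderCode V) (hν : Correctable 0 V ν) : D.decode V (c + ν) = c := by
  by_contra hne
  have hg := D.decode_mem V (c + ν)
  have hle := D.hamming_decode_le V (c + ν) c hc
  generalize D.decode V (c + ν) = g at hne hg hle
  have hf0 : g + c ≠ 0 := fun h => hne <| funext fun x => by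
    have hx : g x + c x = 0 := congrFun h x
    exact CharTwo.add_eq_zero.mp hx
  have hlt := hν (g + c) (add_mem_firstOrderCode hg hc) hf0
  have e1 : {x | (c + ν) x ≠ c x} = {x | ν x = 1} := by
    ext x
    simp only [Set.mem_ofPred_eq, Pi.add_apply]
    generalize c x = p
    generalize ν x = q
    revert p q; decide
  have e2 : {x | (c + ν) x ≠ g x} =
      ({x | (g + c) x = 1} \ {x | ν x = 1}) ∪ ({x | ν x = 1} \ {x | (g + c) x = 1}) := by
    ext x
    simp only [Set.mem_ofPred_eq, Pi.add_apply, Set.mem_union, Set.mem_sdiff]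
    generalize c x = p
    generalize ν x = q
    generalize g x = r
    revert p q r; decide
  rw [hamming, hamming, e1, e2, Set.ncard_union_eq
    (Set.disjoint_left.mpr fun x h h' => h.2 h'.1)] at hle
  have e3 := Set.ncard_inter_add_ncard_sdiff_eq_ncard {x | (g + c) x = 1} {x | ν x = 1}
  have e4 := Set.ncard_inter_add_ncard_sdiff_eq_ncard {x | ν x = 1} {x | (g + c) x = 1}
  rw [Set.inter_comm] at e4
  have e5 : {x | (g + c) x = 1 ∧ ν x = 1} = {x | (g + c) x = 1} ∩ {x | ν x = 1} := rfl
  rw [e5] at hlt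
  omega

/-- When all projections are decoded correctly, the lines that disagree at `x` correspond to the
points at which the noise differs from its value at `x`. -/
theorem disagreements_project {V : Type} [AddCommGroup V] [Module (ZMod 2) V]
    (c ν : V → ZMod 2) (x : V) :
    disagreements (c + ν) (fun B => project c B.1) x = {y | ν y ≠ ν x}.ncard := by
  have hsub : ∀ y ∈ {y | ν y ≠ ν x}, y - x ≠ 0 := fun y hy h => hy (by rw [sub_eq_zero.mp h])
  have hdis : ∀ (b : V) (hb : b ≠ 0),
      project (c + ν) (lineThrough b hb).1 ((lineThrough b hb).1.mkQ x) ≠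
        project c (lineThrough b hb).1 ((lineThrough b hb).1.mkQ x) ↔ ν (x + b) ≠ ν x := by
    intro b hb
    rw [project_add, Pi.add_apply, project_mkQ hb (mem_lineThrough b hb) ν, ne_eq, add_eq_left,
      CharTwo.add_eq_zero, eq_comm]
  refine (Set.ncard_congr (fun y hy => lineThrough (y - x) (hsub y hy)) ?_ ?_ ?_).symm
  · intro y hy
    refine (hdis _ _).mpr ?_
    rwa [add_sub_cancel]
  · intro y z _ _ h
    exact sub_left_injective (lineThrough_injective h)
  · intro B hB
    obtain ⟨b, hb, rfl⟩ := lineThrough_surjective B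
    refine ⟨x + b, (hdis b hb).mp hB, ?_⟩
    simp only [add_sub_cancel_left]

/-- Noise of weight less than half of the length is removed exactly by the majority vote. The number
of lines is one less than the number of points, so strictness of the inequality matters. -/
theorem aggregate_project (c ν : V → ZMod 2) (hν : 2 * {x | ν x = 1}.ncard < Nat.card V) :
    aggregate (c + ν) (fun B => project c B.1) = c := by
  funext x
  have hcard := card_line_add_one (V := V)
  have hcompl := Set.ncard_add_ncard_compl {y | ν y = 1}
  rw [aggregate, disagreements_project, Pi.add_apply]
  by_cases hx : ν x = 1
  · have e : {y | ν y ≠ ν x} = {y | ν y = 1}ᶜ := by ext y; simp [hx]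
    have hlt : Nat.card (Line V) < 2 * {y | ν y ≠ ν x}.ncard := by rw [e]; omega
    have hlt' : (Nat.card (Line V) : ℝ) < 2 * ({y | ν y ≠ ν x}.ncard : ℝ) := by
      exact_mod_cast hlt
    rw [if_pos (by linarith), hx, add_assoc, CharTwo.add_self_eq_zero, add_zero]
  · have h0 : ν x = 0 := by by_contra h; exact hx (eq_one_of_ne_zero h)
    have e : {y | ν y ≠ ν x} = {y | ν y = 1} := by
      ext y
      simp only [h0, Set.mem_ofPred_eq]
      exact ⟨eq_one_of_ne_zero, fun h => by rw [h]; exact one_ne_zero⟩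
    have hle : 2 * {y | ν y ≠ ν x}.ncard ≤ Nat.card (Line V) := by rw [e]; omega
    have hle' : 2 * ({y | ν y ≠ ν x}.ncard : ℝ) ≤ (Nat.card (Line V) : ℝ) := by
      exact_mod_cast hle
    rw [if_neg (by linarith), h0, add_zero, add_zero]

theorem iterate_eq_of_step_eq {V : Type} {step : (V → ZMod 2) → (V → ZMod 2)}
    {Y c : V → ZMod 2} (hY : step Y = c) (hc : step c = c) {M : ℕ} (hM : 1 ≤ M) :
    iterate step M Y = c := by
  obtain ⟨M, rfl⟩ := Nat.exists_eq_add_of_le' hM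
  rw [iterate]
  split_ifs with h
  · rw [h, hY]
  · rw [hY]
    cases M with
    | zero => rfl
    | succ M => rw [iterate, if_pos hc.symm]

/-- On correctable noise a single iteration recovers the codeword, which the decoder then keeps,
because the zero noise is correctable as well. -/
theorem rpa_eq_of_correctable (D : FirstOrderMLDecoder) {M : ℕ} (hM : 1 ≤ M) (k : ℕ) :
    ∀ (V : Type) [AddCommGroup V] [Module (ZMod 2) V] [Finite V] {c ν : V → ZMod 2},
      c ∈ DegreeLT (k + 2) V → Correctable k V ν → rpa D M (k + 1) V (c + ν) = c := by
  induction k with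
  | zero => exact fun V _ _ _ c ν hc hν => decode_eq_of_correctable D (degreeLT_two_subset hc) hν
  | succ k ih =>
    intro V _ _ _ c ν hc hν
    have hstep : ∀ ν' : V → ZMod 2, Correctable (k + 1) V ν' →
        aggregate (c + ν') (fun B => rpa D M (k + 1) (V ⧸ B.1) (project (c + ν') B.1)) = c := by
      intro ν' hν'
      have hproj : ∀ B : Line V,
          rpa D M (k + 1) (V ⧸ B.1) (project (c + ν') B.1) = project c B.1 := fun B => by
        rw [project_add]
        exact ih (V ⧸ B.1) (project_mem_degreeLT hc B) (hν'.2 B)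
      simp only [hproj]
      exact aggregate_project c ν' hν'.1
    have h0 := hstep 0 (correctable_zero _ V)
    rw [add_zero] at h0
    exact iterate_eq_of_step_eq (hstep ν hν) h0 hM

end Correctable

/-! ### Bernoulli noise -/

/-- The probability of the value `a` of a bit with bias `θ`, that is, of a Bernoulli bit of
parameter `(1 - θ) / 2`. -/
noncomputable def bitProb (θ : ℝ) (a : ZMod 2) : ℝ := if a = 1 then (1 - θ) / 2 else (1 + θ) / 2

theorem bitProb_nonneg {θ : ℝ} (h0 : 0 ≤ θ) (h1 : θ ≤ 1) (a : ZMod 2) : 0 ≤ bitProb θ a := by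
  unfold bitProb
  split_ifs <;> linarith

theorem sum_zmod_two (g : ZMod 2 → ℝ) : ∑ a, g a = g 0 + g 1 := Fin.sum_univ_two g

/-- The sum of two independent bits of bias `θ` has bias `θ ^ 2`. -/
theorem sum_bitProb_mul_bitProb (θ : ℝ) (b : ZMod 2) :
    ∑ a, bitProb θ a * bitProb θ (b + a) = bitProb (θ ^ 2) b := by
  rw [sum_zmod_two]
  rcases eq_zero_or_eq_one b with rfl | rfl
  · simp only [bitProb, add_zero, zero_add, zero_ne_one, if_true, if_false]
    ring
  · simp only [bitProb, add_zero, CharTwo.add_self_eq_zero, zero_ne_one, if_true, if_false]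
    ring

section Noise

variable {V : Type} [Fintype V]

/-- The probability of the word `ν` when the bits are independent with bias `θ`. -/
noncomputable def wordProb (θ : ℝ) (ν : V → ZMod 2) : ℝ := ∏ x, bitProb θ (ν x)

theorem wordProb_nonneg {θ : ℝ} (h0 : 0 ≤ θ) (h1 : θ ≤ 1) (ν : V → ZMod 2) :
    0 ≤ wordProb θ ν := Finset.prod_nonneg fun _ _ => bitProb_nonneg h0 h1 _

open scoped Classical in
/-- The probability that a word of independent bits with bias `θ` lies in `S`. -/
noncomputable def noiseMass (θ : ℝ) (S : Set (V → ZMod 2)) : ℝ :=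
  ∑ ν : V → ZMod 2, S.indicator (wordProb θ) ν

theorem noiseMass_nonneg {θ : ℝ} (h0 : 0 ≤ θ) (h1 : θ ≤ 1) (S : Set (V → ZMod 2)) :
    0 ≤ noiseMass θ S :=
  Finset.sum_nonneg fun _ _ => Set.indicator_nonneg (fun _ _ => wordProb_nonneg h0 h1 _) _

theorem noiseMass_mono {θ : ℝ} (h0 : 0 ≤ θ) (h1 : θ ≤ 1) {S T : Set (V → ZMod 2)} (h : S ⊆ T) :
    noiseMass θ S ≤ noiseMass θ T :=
  Finset.sum_le_sum fun _ _ =>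
    Set.indicator_le_indicator_of_subset h (fun _ => wordProb_nonneg h0 h1 _) _

theorem noiseMass_union_le {θ : ℝ} (h0 : 0 ≤ θ) (h1 : θ ≤ 1) (S T : Set (V → ZMod 2)) :
    noiseMass θ (S ∪ T) ≤ noiseMass θ S + noiseMass θ T := by
  classical
  rw [noiseMass, noiseMass, noiseMass, ← Finset.sum_add_distrib]
  refine Finset.sum_le_sum fun ν _ => ?_
  have h := wordProb_nonneg h0 h1 ν
  simp only [Set.indicator_apply, Set.mem_union]
  split_ifs <;> first | linarith | tauto

theorem noiseMass_iUnion_le {θ : ℝ} (h0 : 0 ≤ θ) (h1 : θ ≤ 1) {ι : Type*} [Finite ι]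
    (S : ι → Set (V → ZMod 2)) {K : ℝ} (hK : ∀ i, noiseMass θ (S i) ≤ K) :
    noiseMass θ (⋃ i, S i) ≤ Nat.card ι * K := by
  classical
  have := Fintype.ofFinite ι
  have key : ∀ t : Finset ι, noiseMass θ (⋃ i ∈ t, S i) ≤ t.card * K := by
    intro t
    induction t using Finset.induction_on with
    | empty => simp [noiseMass]
    | insert i t hi ih =>
      rw [Finset.set_biUnion_insert, Finset.card_insert_of_notMem hi, Nat.cast_succ]
      have h2 := noiseMass_union_le h0 h1 (S i) (⋃ j ∈ t, S j)
      have h3 := hK i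
      linarith
  simpa [Nat.card_eq_fintype_card] using key Finset.univ

/-- A Chernoff bound: the probability that at least half of the bits indexed by `S` are one. The
exponential moment is taken at `s = 1 + θ`, where `(1 - θ) / 2 * s + (1 + θ) / 2 / s` is exactly
`1 - θ ^ 2 / 2`. -/
theorem noiseMass_majority_le {θ : ℝ} (h0 : 0 ≤ θ) (h1 : θ ≤ 1) (S : Set V) :
    noiseMass θ {ν | S.ncard ≤ 2 * {x | x ∈ S ∧ ν x = 1}.ncard} ≤ (1 - θ ^ 2 / 2) ^ S.ncard := by
  classical
  have hs : 0 < 1 + θ := by linarith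
  let g : V → ZMod 2 → ℝ := fun x a =>
    if x ∈ S then (if a = 1 then 1 + θ else (1 + θ)⁻¹) else 1
  have hprod : ∀ ν : V → ZMod 2, ∏ x, g x (ν x) =
      (1 + θ) ^ {x | x ∈ S ∧ ν x = 1}.ncard *
        ((1 + θ)⁻¹) ^ (S.ncard - {x | x ∈ S ∧ ν x = 1}.ncard) := by
    intro ν
    have hadd := Set.ncard_inter_add_ncard_sdiff_eq_ncard S {x | ν x = 1}
    have e1 : {x | x ∈ S ∧ ν x = 1}.ncard = ((S.toFinset).filter fun x => ν x = 1).card := by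
      rw [Set.ncard_eq_toFinset_card']
      congr 1
      ext x
      simp
    have e2 : (S \ {x | ν x = 1}).ncard = ((S.toFinset).filter fun x => ¬ ν x = 1).card := by
      rw [Set.ncard_eq_toFinset_card']
      congr 1
      ext x
      simp
    have e3 : S ∩ {x | ν x = 1} = {x | x ∈ S ∧ ν x = 1} := rfl
    rw [e3] at hadd
    have e4 : ∏ x, g x (ν x) = ∏ x ∈ S.toFinset, if ν x = 1 then 1 + θ else (1 + θ)⁻¹ := by
      have e5 : S.toFinset = Finset.univ.filter fun x => x ∈ S := by ext x; simp
      rw [e5, Finset.prod_filter]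
    rw [e4, Finset.prod_ite, Finset.prod_const, Finset.prod_const, ← e1, ← e2,
      Nat.sub_eq_of_eq_add' hadd.symm]
  have hsum : ∀ x, ∑ a, bitProb θ a * g x a = if x ∈ S then 1 - θ ^ 2 / 2 else 1 := by
    intro x
    rw [sum_zmod_two]
    simp only [g, bitProb, zero_ne_one, if_true, if_false]
    split_ifs
    · field_simp
      ring
    · ring
  calc noiseMass θ {ν | S.ncard ≤ 2 * {x | x ∈ S ∧ ν x = 1}.ncard}
      ≤ ∑ ν : V → ZMod 2, ∏ x, bitProb θ (ν x) * g x (ν x) := by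
        refine Finset.sum_le_sum fun ν _ => ?_
        rw [Finset.prod_mul_distrib, hprod]
        have hw := wordProb_nonneg h0 h1 ν
        refine Set.indicator_apply_le' (fun hν => ?_) (fun _ => mul_nonneg hw (by positivity))
        refine le_mul_of_one_le_right hw ?_
        have hν' : S.ncard - {x | x ∈ S ∧ ν x = 1}.ncard ≤ {x | x ∈ S ∧ ν x = 1}.ncard := by
          have : S.ncard ≤ 2 * {x | x ∈ S ∧ ν x = 1}.ncard := hν
          omega
        rw [inv_pow, ← div_eq_mul_inv, one_le_div (by positivity)]
        exact pow_le_pow_right₀ (by linarith) hν'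
    _ = ∏ x, ∑ a, bitProb θ a * g x a :=
        (Fintype.prod_sum fun x a => bitProb θ a * g x a).symm
    _ = (1 - θ ^ 2 / 2) ^ S.ncard := by
        simp only [hsum]
        rw [← Finset.prod_filter, Finset.prod_const, Set.ncard_eq_toFinset_card']
        congr 2
        ext x
        simp

end Noise

/-- Projecting onto a line turns independent bits of bias `θ` into independent bits of bias
`θ ^ 2`. -/
theorem noiseMass_project {V : Type} [AddCommGroup V] [Module (ZMod 2) V] [Fintype V] (B : Line V)
    [Fintype (V ⧸ B.1)] (θ : ℝ) (S : Set ((V ⧸ B.1) → ZMod 2)) :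
    noiseMass θ {ν : V → ZMod 2 | project ν B.1 ∈ S} = noiseMass (θ ^ 2) S := by
  classical
  obtain ⟨b, hb, hB⟩ := B.exists_direction
  let s : V ⧸ B.1 → V := Function.surjInv B.1.mkQ_surjective
  have hs : ∀ T, B.1.mkQ (s T) = T := Function.surjInv_eq B.1.mkQ_surjective
  have hsb : ∀ T, B.1.mkQ (s T + b) = T := fun T =>
    ((mkQ_eq_iff hB (s T) (s T + b)).mpr (Or.inr rfl)).trans (hs T)
  -- The two points of each coset, given by a section of the quotient map, enumerate `V`.
  let e : (V ⧸ B.1) ⊕ (V ⧸ B.1) ≃ V := Equiv.ofBijective (Sum.elim s fun T => s T + b) <| by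
    constructor
    · rintro (T | T) (T' | T') h
      · rw [Sum.elim_inl, Sum.elim_inl] at h
        rw [← hs T, h, hs T']
      · rw [Sum.elim_inl, Sum.elim_inr] at h
        have hT : T = T' := by rw [← hs T, h, hsb T']
        subst hT
        exact absurd h (by simpa using hb)
      · rw [Sum.elim_inl, Sum.elim_inr] at h
        have hT : T = T' := by rw [← hsb T, h, hs T']
        subst hT
        exact absurd h (by simpa using hb)
      · rw [Sum.elim_inr, Sum.elim_inr] at h
        rw [← hsb T, h, hsb T']
    · intro x
      rcases (mkQ_eq_iff hB (s (B.1.mkQ x)) x).mp (hs _).symm with h | h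
      · exact ⟨Sum.inl _, h.symm⟩
      · exact ⟨Sum.inr _, h.symm⟩
  let E : ((V ⧸ B.1) → ZMod 2) × ((V ⧸ B.1) → ZMod 2) ≃ (V → ZMod 2) :=
    (Equiv.sumArrowEquivProdArrow _ _ _).symm.trans (Equiv.arrowCongr e (Equiv.refl _))
  have hE1 : ∀ α β T, E (α, β) (s T) = α T := fun α β T => by
    change Sum.elim α β (e.symm (e (Sum.inl T))) = α T
    rw [e.symm_apply_apply, Sum.elim_inl]
  have hE2 : ∀ α β T, E (α, β) (s T + b) = β T := fun α β T => by
    change Sum.elim α β (e.symm (e (Sum.inr T))) = β T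
    rw [e.symm_apply_apply, Sum.elim_inr]
  have hproj : ∀ α β, project (E (α, β)) B.1 = β + α := fun α β => by
    funext T
    conv_lhs => rw [← hs T]
    rw [project_mkQ hb hB, hE1, hE2, Pi.add_apply, add_comm]
  have hprob : ∀ α β, wordProb θ (E (α, β)) = wordProb θ α * wordProb θ β := fun α β => by
    rw [wordProb, ← e.prod_comp, Fintype.prod_sum_type]
    congr 1
    · exact Finset.prod_congr rfl fun T _ => congrArg _ (hE1 α β T)
    · exact Finset.prod_congr rfl fun T _ => congrArg _ (hE2 α β T)
  have hconv : ∀ μ : (V ⧸ B.1) → ZMod 2,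
      ∑ α, wordProb θ α * wordProb θ (μ + α) = wordProb (θ ^ 2) μ := fun μ => by
    simp only [wordProb, ← Finset.prod_mul_distrib, Pi.add_apply, ← sum_bitProb_mul_bitProb]
    exact (Fintype.prod_sum fun T a => bitProb θ a * bitProb θ (μ T + a)).symm
  calc noiseMass θ {ν : V → ZMod 2 | project ν B.1 ∈ S}
      = ∑ α, ∑ β, if β + α ∈ S then wordProb θ α * wordProb θ β else 0 := by
        rw [noiseMass, ← E.sum_comp, Fintype.sum_prod_type]
        simp only [Set.indicator_apply, Set.mem_ofPred_eq, hproj, hprob]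
    _ = ∑ α, ∑ μ, if μ ∈ S then wordProb θ α * wordProb θ (μ + α) else 0 := by
        refine Finset.sum_congr rfl fun α _ => ?_
        rw [← Equiv.sum_comp (Equiv.addRight α) fun β =>
          if β + α ∈ S then wordProb θ α * wordProb θ β else 0]
        refine Finset.sum_congr rfl fun μ _ => ?_
        have h2 : α + α = 0 := funext fun T => CharTwo.add_self_eq_zero _
        simp only [Equiv.coe_addRight, add_assoc, h2, add_zero]
    _ = noiseMass (θ ^ 2) S := by
        rw [Finset.sum_comm, noiseMass]
        refine Finset.sum_congr rfl fun μ _ => ?_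
        rw [Set.indicator_apply]
        split_ifs
        · exact hconv μ
        · exact Finset.sum_const_zero

/-! ### The probability of uncorrectable noise -/

section FailureBound

variable {V : Type} [AddCommGroup V] [Module (ZMod 2) V]

/-- A nonzero affine function takes the value one on at least half of the space. -/
theorem card_le_two_mul_ncard_support [Finite V] {f : V → ZMod 2} (hf : f ∈ firstOrderCode V)
    (hf0 : f ≠ 0) : Nat.card V ≤ 2 * {x | f x = 1}.ncard := by
  obtain ⟨l, a, hla⟩ := hf
  have hcompl := Set.ncard_add_ncard_compl {x | f x = 1}
  by_cases hl : ∃ v, l v = 1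
  · obtain ⟨v, hv⟩ := hl
    have h : {x | f x = 1}ᶜ.ncard = {x | f x = 1}.ncard := by
      have hflip : ∀ x, f (x + v) = f x + 1 := fun x => by
        rw [hla, hla, map_add, hv]
        ring
      refine Set.ncard_congr (fun x _ => x + v) ?_ (fun x y _ _ h => add_right_cancel h) ?_
      · intro x hx
        have hx0 : f x = 0 := (eq_zero_or_eq_one _).resolve_right hx
        change f (x + v) = 1
        rw [hflip, hx0, zero_add]
      · intro y hy
        refine ⟨y + v, ?_, ?_⟩
        · change ¬ f (y + v) = 1
          rw [hflip, show f y = 1 from hy]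
          decide
        · rw [add_assoc, ZModModule.add_self, add_zero]
    omega
  · have hl0 : ∀ v, l v = 0 := fun v =>
      (eq_zero_or_eq_one _).resolve_right fun h => hl ⟨v, h⟩
    have ha : a = 1 := eq_one_of_ne_zero fun h => hf0 <| funext fun x => by
      rw [hla, hl0, h]
      rfl
    have huniv : {x | f x = 1} = Set.univ := by
      ext x
      simp [hla, hl0, ha]
    rw [huniv, Set.ncard_univ]
    omega

theorem card_affine [Finite V] :
    Nat.card ((V →ₗ[ZMod 2] ZMod 2) × ZMod 2) = 2 ^ (Module.finrank (ZMod 2) V + 1) := by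
  have : Module.Finite (ZMod 2) V := Module.Finite.of_finite
  have h : Nat.card (V →ₗ[ZMod 2] ZMod 2) = 2 ^ Module.finrank (ZMod 2) V := by
    have h1 := Module.natCard_eq_pow_finrank (K := ZMod 2) (V := Module.Dual (ZMod 2) V)
    rwa [Subspace.dual_finrank_eq, Nat.card_zmod] at h1
  rw [Nat.card_prod, h, Nat.card_zmod, pow_succ]

theorem noiseMass_not_correctable_zero_le [Fintype V] {θ : ℝ} (h0 : 0 ≤ θ) (h1 : θ ≤ 1) :
    noiseMass θ {ν : V → ZMod 2 | ¬ Correctable 0 V ν} ≤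
      2 ^ (Module.finrank (ZMod 2) V + 1) *
        (1 - θ ^ 2 / 2) ^ 2 ^ (Module.finrank (ZMod 2) V - 1) := by
  have : Module.Finite (ZMod 2) V := Module.Finite.of_finite
  have : Finite (V →ₗ[ZMod 2] ZMod 2) := Finite.of_injective _ DFunLike.coe_injective
  have hq0 : 0 ≤ 1 - θ ^ 2 / 2 := by nlinarith
  have hq1 : 1 - θ ^ 2 / 2 ≤ 1 := by nlinarith
  let f : (V →ₗ[ZMod 2] ZMod 2) × ZMod 2 → V → ZMod 2 := fun i x => i.1 x + i.2
  have hsub : {ν : V → ZMod 2 | ¬ Correctable 0 V ν} ⊆ ⋃ i, {ν | f i ≠ 0 ∧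
      {x | f i x = 1}.ncard ≤ 2 * {x | f i x = 1 ∧ ν x = 1}.ncard} := by
    intro ν hν
    simp only [Correctable, Set.mem_ofPred_eq, not_forall, not_lt] at hν
    obtain ⟨g, ⟨l, a, hla⟩, hg0, hg⟩ := hν
    obtain rfl : g = f (l, a) := funext hla
    exact Set.mem_iUnion.mpr ⟨(l, a), hg0, hg⟩
  refine (noiseMass_mono h0 h1 hsub).trans ?_
  have hcast : ((Nat.card ((V →ₗ[ZMod 2] ZMod 2) × ZMod 2) : ℕ) : ℝ) =
      2 ^ (Module.finrank (ZMod 2) V + 1) := by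
    rw [card_affine]
    push_cast
    rfl
  rw [← hcast]
  refine noiseMass_iUnion_le h0 h1 _ fun i => ?_
  by_cases hi : f i = 0
  · simp only [hi, ne_eq, not_true_eq_false, false_and]
    simpa [noiseMass] using pow_nonneg hq0 _
  · refine (noiseMass_mono h0 h1 (fun ν hν => hν.2)).trans
      ((noiseMass_majority_le h0 h1 {x | f i x = 1}).trans ?_)
    refine pow_le_pow_of_le_one hq0 hq1 ?_
    have hcard := card_le_two_mul_ncard_support (f := f i) ⟨i.1, i.2, fun _ => rfl⟩ hi
    rw [natCard_eq_two_pow] at hcard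
    cases h : Module.finrank (ZMod 2) V with
    | zero => rw [h] at hcard; simp only [pow_zero, Nat.zero_sub] at hcard ⊢; omega
    | succ n => rw [h, pow_succ] at hcard; rw [Nat.add_sub_cancel]; omega

/-- In dimension `n`, projecting `k` times leaves words of length `2 ^ (n - k)` whose bits have bias
`θ ^ 2 ^ k`, and a nonzero affine function is supported on at least `2 ^ (n - (k + 1))` of them; the
union bound ranges over at most `2 ^ ((n + 1) * (k + 1))` events. The truncated subtraction is
harmless: for `n ≤ k` the exponent is one, and the supports are nonempty. -/
theorem noiseMass_not_correctable_le (k : ℕ) :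
    ∀ (V : Type) [AddCommGroup V] [Module (ZMod 2) V] [Fintype V] {θ : ℝ}, 0 ≤ θ → θ ≤ 1 →
      noiseMass θ {ν : V → ZMod 2 | ¬ Correctable k V ν} ≤
        2 ^ ((Module.finrank (ZMod 2) V + 1) * (k + 1)) *
          (1 - θ ^ 2 ^ (k + 1) / 2) ^ 2 ^ (Module.finrank (ZMod 2) V - (k + 1)) := by
  induction k with
  | zero =>
    intro V _ _ _ θ h0 h1
    simpa using noiseMass_not_correctable_zero_le h0 h1
  | succ k ih =>
    intro V _ _ _ θ h0 h1
    have hn := natCard_eq_two_pow V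
    have hrank := fun B : Line V => finrank_quotient_line B
    generalize Module.finrank (ZMod 2) V = n at hn hrank ⊢
    have hθpow : θ ^ 2 ^ (k + 1 + 1) ≤ θ ^ 2 :=
      pow_le_pow_of_le_one h0 h1 (by
        calc 2 = 2 ^ 1 := rfl
          _ ≤ 2 ^ (k + 1 + 1) := Nat.pow_le_pow_right two_pos (by omega))
    have hsq0 : 0 ≤ θ ^ 2 := sq_nonneg θ
    have hsq1 : θ ^ 2 ≤ 1 := by nlinarith
    have hbig0 : 0 ≤ θ ^ 2 ^ (k + 1 + 1) := pow_nonneg h0 _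
    set Q : ℝ := (1 - θ ^ 2 ^ (k + 1 + 1) / 2) ^ 2 ^ (n - (k + 1 + 1)) with hQ
    have hQ0 : 0 ≤ Q := pow_nonneg (by linarith) _
    have hsub : {ν : V → ZMod 2 | ¬ Correctable (k + 1) V ν} ⊆
        {ν | (Set.univ : Set V).ncard ≤ 2 * {x | x ∈ Set.univ ∧ ν x = 1}.ncard} ∪
          ⋃ B : Line V, {ν | project ν B.1 ∈ {μ | ¬ Correctable k (V ⧸ B.1) μ}} := by
      intro ν hν
      by_cases hw : 2 * {x | ν x = 1}.ncard < Nat.card V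
      · right
        have hν' : ¬ ∀ B : Line V, Correctable k (V ⧸ B.1) (project ν B.1) := fun h => hν ⟨hw, h⟩
        obtain ⟨B, hB⟩ := not_forall.mp hν'
        exact Set.mem_iUnion.mpr ⟨B, hB⟩
      · left
        simpa [Set.ncard_univ] using hw
    have hlines : ∀ B : Line V,
        noiseMass θ {ν : V → ZMod 2 | project ν B.1 ∈ {μ | ¬ Correctable k (V ⧸ B.1) μ}} ≤
          2 ^ ((n + 1) * (k + 1)) * Q := by
      intro B
      let _ : Fintype (V ⧸ B.1) := Fintype.ofFinite _
      rw [noiseMass_project B]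
      refine (ih (V ⧸ B.1) hsq0 hsq1).trans ?_
      rw [hrank B, ← pow_mul, ← pow_succ', Nat.sub_sub, add_comm 1 (k + 1)]
      refine mul_le_mul_of_nonneg_right (pow_le_pow_right₀ one_le_two ?_) hQ0
      exact Nat.mul_le_mul_right _ (by omega)
    have hweight : noiseMass θ
        {ν : V → ZMod 2 | (Set.univ : Set V).ncard ≤
          2 * {x | x ∈ Set.univ ∧ ν x = 1}.ncard} ≤ Q := by
      refine (noiseMass_majority_le h0 h1 Set.univ).trans ?_
      rw [Set.ncard_univ, hn]
      calc (1 - θ ^ 2 / 2) ^ 2 ^ n ≤ (1 - θ ^ 2 ^ (k + 1 + 1) / 2) ^ 2 ^ n :=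
            pow_le_pow_left₀ (by linarith) (by linarith) _
        _ ≤ Q := pow_le_pow_of_le_one (by linarith) (by linarith)
            (Nat.pow_le_pow_right two_pos (Nat.sub_le _ _))
    have hcard : (Nat.card (Line V) : ℝ) + 1 = 2 ^ n := by
      exact_mod_cast (card_line_add_one (V := V)).trans hn
    have hone : (1 : ℝ) ≤ 2 ^ ((n + 1) * (k + 1)) := one_le_pow₀ one_le_two
    calc noiseMass θ {ν : V → ZMod 2 | ¬ Correctable (k + 1) V ν}
        ≤ Q + Nat.card (Line V) * (2 ^ ((n + 1) * (k + 1)) * Q) :=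
          (noiseMass_mono h0 h1 hsub).trans ((noiseMass_union_le h0 h1 _ _).trans
            (add_le_add hweight (noiseMass_iUnion_le h0 h1 _ hlines)))
      _ ≤ 2 ^ ((n + 1) * (k + 1)) * Q + Nat.card (Line V) * (2 ^ ((n + 1) * (k + 1)) * Q) := by
          gcongr
          exact le_mul_of_one_le_left hQ0 hone
      _ = 2 ^ n * 2 ^ ((n + 1) * (k + 1)) * Q := by rw [← hcard]; ring
      _ ≤ 2 ^ ((n + 1) * (k + 1 + 1)) * Q := by
          rw [← pow_add]
          refine mul_le_mul_of_nonneg_right (pow_le_pow_right₀ one_le_two ?_) hQ0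
          rw [mul_add _ (k + 1) 1]
          omega

end FailureBound

theorem noiseProb_eq_wordProb (p : ℝ) {m : ℕ} (ν : Cube m → ZMod 2) :
    noiseProb p ν = wordProb (1 - 2 * p) ν := by
  refine Finset.prod_congr rfl fun z _ => ?_
  unfold bitProb
  split_ifs <;> ring

theorem noiseProb_nonneg {p : ℝ} (hp0 : 0 ≤ p) (hp1 : p ≤ 1) {m : ℕ} (ν : Cube m → ZMod 2) :
    0 ≤ noiseProb p ν :=
  Finset.prod_nonneg fun _ _ => by split_ifs <;> linarith

theorem errorProb_nonneg (D : FirstOrderMLDecoder) (M : ℕ) {p : ℝ} (hp0 : 0 ≤ p) (hp1 : p ≤ 1)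
    (m r : ℕ) : 0 ≤ errorProb D M p m r := by
  refine div_nonneg (Finset.sum_nonneg fun c _ => Finset.sum_nonneg fun ν _ => ?_)
    (Nat.cast_nonneg _)
  split_ifs
  · exact noiseProb_nonneg hp0 hp1 ν
  · exact le_rfl

theorem errorProb_le (D : FirstOrderMLDecoder) {M : ℕ} (hM : 1 ≤ M) {p : ℝ} (hp0 : 0 ≤ p)
    (hp1 : p ≤ 1 / 2) (m k : ℕ) :
    errorProb D M p m (k + 1) ≤ 2 ^ ((m + 1) * (k + 1)) *
      (1 - (1 - 2 * p) ^ 2 ^ (k + 1) / 2) ^ 2 ^ (m - (k + 1)) := by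
  classical
  have h0 : 0 ≤ 1 - 2 * p := by linarith
  have h1 : 1 - 2 * p ≤ 1 := by linarith
  have hmass := noiseMass_not_correctable_le k (Cube m) h0 h1
  rw [Module.finrank_fin_fun] at hmass
  refine le_trans ?_ hmass
  have hword : ∀ c ∈ reedMuller m (k + 1), wordErrorProb D M p m (k + 1) c ≤
      noiseMass (1 - 2 * p) {ν : Cube m → ZMod 2 | ¬ Correctable k (Cube m) ν} := by
    intro c hc
    unfold wordErrorProb noiseMass
    refine le_of_eq_of_le (Finset.sum_congr (by congr!) fun _ _ => rfl)
      (Finset.sum_le_sum fun ν _ => ?_)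
    rw [Set.indicator_apply, noiseProb_eq_wordProb]
    have hw := wordProb_nonneg h0 h1 ν
    by_cases hν : Correctable k (Cube m) ν
    · have hrpa := rpa_eq_of_correctable D hM k (Cube m) (reedMuller_subset_degreeLT m (k + 1) hc) hν
      simp [hrpa, hν]
    · rw [if_pos (show ν ∈ {ν : Cube m → ZMod 2 | ¬ Correctable k (Cube m) ν} from hν)]
      split_ifs <;> linarith
  unfold errorProb
  refine div_le_of_le_mul₀ (Nat.cast_nonneg _) (noiseMass_nonneg h0 h1 _) ?_
  refine (Finset.sum_le_card_nsmul _ _ _ fun c _ => hword c.1 c.2).trans_eq ?_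
  rw [nsmul_eq_mul, mul_comm, Finset.card_univ]

/-! ### The limit -/

/-- The failure bound in exponential form, when `2 ^ r ≤ cbar * m`. -/
theorem failure_bound_le_exp {θ cbar : ℝ} (hθ0 : 0 < θ) (hθ1 : θ ≤ 1) (hc0 : 0 < cbar) {m r : ℕ}
    (hm : 1 ≤ m) (hr : (2 : ℝ) ^ r ≤ cbar * m) :
    2 ^ ((m + 1) * r) * (1 - θ ^ 2 ^ r / 2) ^ 2 ^ (m - r) ≤
      Real.exp (2 * cbar * m ^ 2 - (2 * θ ^ cbar) ^ m / (2 * cbar * m)) := by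
  have hm' : (1 : ℝ) ≤ m := by exact_mod_cast hm
  have hcm : 0 < cbar * m := by positivity
  have hrcm : (r : ℝ) ≤ cbar * m := by
    have h : (r : ℝ) ≤ 2 ^ r := by exact_mod_cast (Nat.lt_two_pow_self (n := r)).le
    exact h.trans hr
  have hcount : (2 : ℝ) ^ ((m + 1) * r) ≤ Real.exp (2 * cbar * m ^ 2) := by
    have h2 : (2 : ℝ) ≤ Real.exp 1 := by linarith [Real.add_one_le_exp (1 : ℝ)]
    calc (2 : ℝ) ^ ((m + 1) * r) ≤ Real.exp 1 ^ ((m + 1) * r) := pow_le_pow_left₀ two_pos.le h2 _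
      _ = Real.exp ((m + 1) * r) := by rw [← Real.exp_nat_mul]; push_cast; rw [mul_one]
      _ ≤ Real.exp (2 * cbar * m ^ 2) := by
          refine Real.exp_le_exp.mpr ?_
          calc ((m : ℝ) + 1) * r ≤ (2 * m) * (cbar * m) := by
                gcongr
                linarith
            _ = 2 * cbar * m ^ 2 := by ring
  have hbias : θ ^ (cbar * m) ≤ θ ^ 2 ^ r := by
    rw [← Real.rpow_natCast θ (2 ^ r)]
    refine Real.rpow_le_rpow_of_exponent_ge hθ0 hθ1 ?_
    push_cast
    exact hr
  have hlen : (2 : ℝ) ^ m / (cbar * m) ≤ 2 ^ (m - r) := by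
    rw [div_le_iff₀ hcm]
    calc (2 : ℝ) ^ m ≤ 2 ^ (m - r + r) := pow_le_pow_right₀ one_le_two (by omega)
      _ = 2 ^ (m - r) * 2 ^ r := pow_add _ _ _
      _ ≤ 2 ^ (m - r) * (cbar * m) := by gcongr
  have hθpow1 : θ ^ 2 ^ r ≤ 1 := pow_le_one₀ hθ0.le hθ1
  have hdecay : (1 - θ ^ 2 ^ r / 2) ^ 2 ^ (m - r) ≤
      Real.exp (-((2 * θ ^ cbar) ^ m / (2 * cbar * m))) := by
    calc (1 - θ ^ 2 ^ r / 2) ^ 2 ^ (m - r) ≤ Real.exp (-(θ ^ 2 ^ r / 2)) ^ 2 ^ (m - r) :=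
          pow_le_pow_left₀ (by linarith) (Real.one_sub_le_exp_neg _) _
      _ = Real.exp (-(2 ^ (m - r) * (θ ^ 2 ^ r / 2))) := by
          rw [← Real.exp_nat_mul]
          push_cast
          rw [mul_neg]
      _ ≤ Real.exp (-((2 * θ ^ cbar) ^ m / (2 * cbar * m))) := by
          refine Real.exp_le_exp.mpr (neg_le_neg ?_)
          calc (2 * θ ^ cbar) ^ m / (2 * cbar * m) = 2 ^ m / (cbar * m) * (θ ^ (cbar * m) / 2) := by
                rw [mul_pow, Real.rpow_mul hθ0.le, Real.rpow_natCast]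
                field_simp
            _ ≤ 2 ^ (m - r) * (θ ^ 2 ^ r / 2) := by gcongr
  calc 2 ^ ((m + 1) * r) * (1 - θ ^ 2 ^ r / 2) ^ 2 ^ (m - r)
      ≤ Real.exp (2 * cbar * m ^ 2) * Real.exp (-((2 * θ ^ cbar) ^ m / (2 * cbar * m))) :=
        mul_le_mul hcount hdecay (pow_nonneg (by linarith) _) (Real.exp_pos _).le
    _ = Real.exp (2 * cbar * m ^ 2 - (2 * θ ^ cbar) ^ m / (2 * cbar * m)) := by
        rw [← Real.exp_add, sub_eq_add_neg]

/-- The condition on `cbar` says that the squared bias at the last level decays more slowly than the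
inverse of the blocklength. -/
theorem one_lt_two_mul_rpow {θ cbar : ℝ} (hθ0 : 0 < θ) (hθ1 : θ < 1)
    (hc : cbar < Real.log 2 / Real.log (1 / θ)) : 1 < 2 * θ ^ cbar := by
  have hlog : 0 < Real.log (1 / θ) := Real.log_pos ((one_lt_div hθ0).mpr hθ1)
  rw [lt_div_iff₀ hlog, one_div, Real.log_inv] at hc
  have hpos : 0 < θ ^ cbar := Real.rpow_pos_of_pos hθ0 _
  rw [← Real.log_pos_iff (by positivity), Real.log_mul two_ne_zero hpos.ne', Real.log_rpow hθ0]
  linarith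

/-- The exponential `β ^ m` beats the polynomial terms. -/
theorem eventually_exponent_le {β cbar : ℝ} (hβ : 1 < β) (hc0 : 0 < cbar) :
    ∀ᶠ m : ℕ in atTop, 2 * cbar * (m : ℝ) ^ 2 - β ^ m / (2 * cbar * m) ≤ -m := by
  have hK : 0 < 2 * cbar * (2 * cbar + 1) := by positivity
  filter_upwards [(tendsto_pow_const_div_const_pow_of_one_lt 3 hβ).eventually
    (gt_mem_nhds (inv_pos.mpr hK)), eventually_ge_atTop 1] with m hm hm1
  have hm' : (1 : ℝ) ≤ m := by exact_mod_cast hm1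
  have hβm : 0 < β ^ m := pow_pos (by linarith) m
  rw [div_lt_iff₀ hβm, inv_mul_eq_div, lt_div_iff₀ hK] at hm
  have h : (2 * cbar + 1) * (m : ℝ) ^ 2 ≤ β ^ m / (2 * cbar * m) := by
    rw [le_div_iff₀ (by positivity)]
    refine le_of_eq_of_le ?_ hm.le
    ring
  nlinarith

end RPA

theorem corollary1
    (p : ℝ) (hp0 : 0 < p) (hp1 : p < 1 / 2)
    (cbar : ℝ) (hc0 : 0 < cbar) (hc : cbar < Real.log 2 / Real.log (1 / (1 - 2 * p)))
    (D : RPA.FirstOrderMLDecoder)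
    (M : ℕ → ℕ) (hM : ∀ m, 1 ≤ M m)
    (r : ℕ → ℕ)
    (hr : ∀ᶠ m : ℕ in atTop, 1 ≤ r m ∧ (r m : ℝ) ≤ Real.logb 2 (cbar * m)) :
    Tendsto (fun m : ℕ => RPA.errorProb D (M m) p m (r m)) atTop (𝓝 0) := by
  have hθ0 : 0 < 1 - 2 * p := by linarith
  have hθ1 : 1 - 2 * p < 1 := by linarith
  have hexp : Tendsto (fun m : ℕ => Real.exp (-(m : ℝ))) atTop (𝓝 0) :=
    Real.tendsto_exp_neg_atTop_nhds_zero.comp tendsto_natCast_atTop_atTop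
  refine squeeze_zero' (Eventually.of_forall fun m =>
    RPA.errorProb_nonneg D (M m) hp0.le (by linarith) m (r m)) ?_ hexp
  filter_upwards [hr, eventually_ge_atTop 1,
    RPA.eventually_exponent_le (RPA.one_lt_two_mul_rpow hθ0 hθ1 hc) hc0] with m hrm hm1 hexpo
  have hm' : (1 : ℝ) ≤ m := by exact_mod_cast hm1
  obtain ⟨k, hk⟩ := Nat.exists_eq_add_of_le' hrm.1
  have hpow : (2 : ℝ) ^ r m ≤ cbar * m := by
    rw [← Real.rpow_natCast]
    exact (Real.le_logb_iff_rpow_le one_lt_two (by positivity)).mp hrm.2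
  rw [hk] at hpow ⊢
  exact (RPA.errorProb_le D (hM m) hp0.le hp1.le m k).trans
    ((RPA.failure_bound_le_exp hθ0 hθ1.le hc0 hm1 hpow).trans (Real.exp_le_exp.mpr hexpo))
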